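/- Let $n\ge 1$, $m\ge 2$ be integers and let $\mathbb F_n^+$ be the free monoid on $g_1,\dots,g_n$, with identity $g_0$ and word length $|\alpha|$. For an integer $N\ge 1$ let $F^2(H_N)$ be the full Fock space of an $N$-dimensional complex Hilbert space $H_N$ with orthonormal basis $e_1,\dots,e_N$, and let $S_i\varphi=e_i\otimes\varphi$ ($1\le i\le N$) be the left creation operators on it. The numerical radius of a bounded operator $T$ is $\omega(T)=\sup\{|\langle Th,h\rangle|:\|h\|=1\}$, and the joint numerical radius of bounded operators $X_1,\dots,X_N$ on a complex Hilbert space is $$w(X_1,\dots,X_N)=\omega\big(S_1\otimes X_1^*+\cdots+S_N\otimes X_N^*\big),$$ where $S_1,\dots,S_N$ act on $F^2(H_N)$. For each $m\ge 2$ the equation $$\sum_{k=1}^{m-1}t^k\cos\frac{\pi}{\left[\frac{m-1}{k}\right]+2}=\frac12 ,$$ where $[x]$ is the integer part of $x$, has a unique solution $t=t_m$ in $(0,1]$. The sequence $(t_m)_{m\ge2}$ is strictly decreasing and converges to $\frac13$. Let $\mathcal H$ be a complex Hilbert space and let $$F(S_1,\dots,S_n)=\sum_{k=0}^{m-1}\sum_{|\alpha|=k}S_\alpha\otimes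 A_{(\alpha)},\qquad A_{(\alpha)}\in B(\mathcal H),$$ with $S_1,\dots,S_n$ the left creation operators on $F^2(H_n)$, and $S_\alpha=S_{i_1}\cdots S_{i_k}$ for $\alpha=g_{i_1}\cdots g_{i_k}$, $S_{g_0}=I$. Put $A_{(0)}=A_{(g_0)}$. If $F(0)=A_{(0)}\ge 0$ and $\operatorname{Re}F(S_1,\dots,S_n)\le I$, then $$w\big(A_{(\alpha)}^*:|\alpha|=k\big)\le 2\,\|I-A_{(0)}\|\cos\frac{\pi}{\left[\frac{m-1}{k}\right]+2}\qquad(1\le k\le m-1)$$ and $$\sum_{k=0}^{m-1}r^k\,w\big(A_{(\alpha)}^*:|\alpha|=k\big)\le\|A_{(0)}\|+\|I-A_{(0)}\|\qquad\text{for every } r\in[0,t_m].$$ -/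

import Mathlib

open scoped TensorProduct

noncomputable section

namespace BohrPoly

/-- The full Fock space `F²(H_N)` of the Hilbert space `H_N` with orthonormal basis
`(e_i)_{i ∈ ι}`, `N = card ι`.  The vectors `e_α = e_{i₁} ⊗ ⋯ ⊗ e_{i_k}`, indexed by the words
`α = g_{i₁} ⋯ g_{i_k}` of the free monoid on `ι`, are an orthonormal basis of it, so that it is
the space of square-summable families of coefficients `(c_α)_α`. -/
abbrev Fock (ι : Type*) : Type _ := lp (fun _ : FreeMonoid ι => ℂ) 2

/-- The Hilbert tensor product of two complex inner product spaces: the completion of the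
algebraic tensor product, with `⟪x ⊗ y, x' ⊗ y'⟫ = ⟪x, x'⟫ ⟪y, y'⟫`. -/
abbrev HilbertTensor (E F : Type*) [NormedAddCommGroup E] [InnerProductSpace ℂ E]
    [NormedAddCommGroup F] [InnerProductSpace ℂ F] : Type _ :=
  UniformSpace.Completion (E ⊗[ℂ] F)

/-- The tensor product `T ⊗ A` of two bounded operators: the bounded operator on the Hilbert
tensor product with `(T ⊗ A) (x ⊗ y) = T x ⊗ A y`. -/
def opTensor {E F : Type*} [NormedAddCommGroup E] [InnerProductSpace ℂ E]
    [NormedAddCommGroup F] [InnerProductSpace ℂ F] (T : E →L[ℂ] E) (A : F →L[ℂ] F) :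
    HilbertTensor E F →L[ℂ] HilbertTensor E F :=
  (TensorProduct.mapL T A).completion

theorem of_mul_injective {ι : Type*} (i : ι) :
    Function.Injective (fun α : FreeMonoid ι => FreeMonoid.of i * α) :=
  fun _ _ h => mul_left_cancel h

/-- The coefficients of `e_i ⊗ φ`: the coefficient at `g_i α` is the coefficient of `φ` at `α`,
and the coefficients at words that do not begin with `g_i` vanish. -/
def creationFun {ι : Type*} (i : ι) (φ : FreeMonoid ι → ℂ) : FreeMonoid ι → ℂ :=
  Function.extend (fun α => FreeMonoid.of i * α) φ 0

theorem creationFun_norm_sq {ι : Type*} (i : ι) (φ : FreeMonoid ι → ℂ) :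
    (fun γ => ‖creationFun i φ γ‖ ^ (2 : ENNReal).toReal) =
      Function.extend (fun α => FreeMonoid.of i * α)
        (fun α => ‖φ α‖ ^ (2 : ENNReal).toReal) 0 := by
  funext γ
  by_cases h : ∃ α, FreeMonoid.of i * α = γ
  · obtain ⟨α, rfl⟩ := h
    simp only [creationFun, (of_mul_injective i).extend_apply]
  · simp only [creationFun, Function.extend_apply' _ _ _ h]
    simp

theorem creationFun_memℓp {ι : Type*} (i : ι) (φ : Fock ι) :
    Memℓp (E := fun _ : FreeMonoid ι => ℂ) (creationFun i φ) 2 := by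
  apply memℓp_gen
  rw [creationFun_norm_sq]
  exact ((hasSum_extend_zero (of_mul_injective i)).2
    ((memℓp_gen_iff (by norm_num)).1 (lp.memℓp φ)).hasSum).summable

theorem creationFun_add {ι : Type*} (i : ι) (φ ψ : FreeMonoid ι → ℂ) :
    creationFun i (φ + ψ) = creationFun i φ + creationFun i ψ := by
  funext γ
  by_cases h : ∃ α, FreeMonoid.of i * α = γ
  · obtain ⟨α, rfl⟩ := h
    simp only [creationFun, Pi.add_apply, (of_mul_injective i).extend_apply]
  · simp only [creationFun, Pi.add_apply, Function.extend_apply' _ _ _ h, Pi.zero_apply, add_zero]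

theorem creationFun_smul {ι : Type*} (i : ι) (c : ℂ) (φ : FreeMonoid ι → ℂ) :
    creationFun i (c • φ) = c • creationFun i φ := by
  funext γ
  by_cases h : ∃ α, FreeMonoid.of i * α = γ
  · obtain ⟨α, rfl⟩ := h
    simp only [creationFun, Pi.smul_apply, (of_mul_injective i).extend_apply]
  · simp only [creationFun, Pi.smul_apply, Function.extend_apply' _ _ _ h, Pi.zero_apply,
      smul_zero]

/-- The left creation operator `S_i φ = e_i ⊗ φ` on the full Fock space, as an isometry. -/
def creationIsometry {ι : Type*} (i : ι) : Fock ι →ₗᵢ[ℂ] Fock ι where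
  toFun φ := ⟨creationFun i φ, creationFun_memℓp i φ⟩
  map_add' φ ψ := Subtype.ext (creationFun_add i φ ψ)
  map_smul' c φ := Subtype.ext (creationFun_smul i c φ)
  norm_map' φ := by
    have h2 : 0 < (2 : ENNReal).toReal := by norm_num
    rw [lp.norm_eq_tsum_rpow h2, lp.norm_eq_tsum_rpow h2]
    congr 1
    change ∑' γ, ‖creationFun i φ γ‖ ^ (2 : ENNReal).toReal = _
    rw [creationFun_norm_sq]
    exact ((hasSum_extend_zero (of_mul_injective i)).2
      ((memℓp_gen_iff h2).1 (lp.memℓp φ)).hasSum).tsum_eq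

/-- The left creation operator `S_i φ = e_i ⊗ φ` on the full Fock space. -/
def creation {ι : Type*} (i : ι) : Fock ι →L[ℂ] Fock ι :=
  (creationIsometry i).toContinuousLinearMap

/-- `S_α = S_{i₁} ⋯ S_{i_k}` for a word `α = g_{i₁} ⋯ g_{i_k}`, and `S_{g₀} = I`. -/
def creationWord {ι : Type*} : FreeMonoid ι →* (Fock ι →L[ℂ] Fock ι) :=
  FreeMonoid.lift creation

/-- The word `g_{i₁} ⋯ g_{i_k}` of length `k`.  Every word of length `k` is of this form for
exactly one `(i₁, …, i_k)`. -/
def word {ι : Type*} {k : ℕ} (i : Fin k → ι) : FreeMonoid ι :=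
  FreeMonoid.ofList (List.ofFn i)

/-- The polynomial `F(S₁, …, S_n) = ∑_{k=0}^{m-1} ∑_{|α|=k} S_α ⊗ A_(α)`. -/
def polyOp {n : ℕ} {H : Type*} [NormedAddCommGroup H] [InnerProductSpace ℂ H]
    (m : ℕ) (A : FreeMonoid (Fin n) → (H →L[ℂ] H)) :
    HilbertTensor (Fock (Fin n)) H →L[ℂ] HilbertTensor (Fock (Fin n)) H :=
  ∑ k ∈ Finset.range m, ∑ i : Fin k → Fin n, opTensor (creationWord (word i)) (A (word i))

/-- The numerical radius `ω(T) = sup {|⟪T h, h⟫| : ‖h‖ = 1}`. -/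
def numRadius {E : Type*} [NormedAddCommGroup E] [InnerProductSpace ℂ E]
    (T : E →L[ℂ] E) : ℝ :=
  sSup {x : ℝ | ∃ h : E, ‖h‖ = 1 ∧ x = ‖inner ℂ (T h) h‖}

/-- The joint numerical radius `w(X_i : i ∈ ι) = ω(∑_i S_i ⊗ X_i^*)` of a finite family of
bounded operators, `S_i` being the left creation operators on the full Fock space of a Hilbert
space with orthonormal basis `(e_i)_{i ∈ ι}`. -/
def jointNumRadius {ι : Type*} [Fintype ι] {H : Type*} [NormedAddCommGroup H]
    [InnerProductSpace ℂ H] [CompleteSpace H] (X : ι → (H →L[ℂ] H)) : ℝ :=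
  numRadius (∑ i, opTensor (creation i) (ContinuousLinearMap.adjoint (X i)))

/-- `w(A_(α)^* : |α| = k)`. -/
def coeffRadius {n : ℕ} {H : Type*} [NormedAddCommGroup H] [InnerProductSpace ℂ H]
    [CompleteSpace H] (A : FreeMonoid (Fin n) → (H →L[ℂ] H)) (k : ℕ) : ℝ :=
  jointNumRadius fun i : Fin k → Fin n => ContinuousLinearMap.adjoint (A (word i))

/-- The Fejér constant `cos (π / ([(m-1)/k] + 2))`, with `[x]` the integer part of `x`. -/
def fejerConst (m k : ℕ) : ℝ :=
  Real.cos (Real.pi / ((⌊((m : ℝ) - 1) / (k : ℝ)⌋ : ℝ) + 2))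

end BohrPoly

end

/-! Write `P_k` for the part of `F` homogeneous of degree `k`. The gauge isometry `U_u`, which
multiplies `e_α` by `u ^ (-|α|)`, satisfies `P_k (U_u ⊗ 1) = u ^ k (U_u ⊗ 1) P_k`. Testing `Re F ≤
I` on `(U_u ⊗ 1) x` for all `u` on the circle therefore says that the scalar trigonometric
polynomial `‖x‖² - Re ∑ u ^ k ⟪x, P_k x⟫`, of degree less than `m`, is nonnegative. Its constant
term is at most `‖I - A_(0)‖ ‖x‖²`, so the Egerváry–Szász inequality (`fejer_coeff_le`) bounds `|⟪x,
P_k x⟫|`; this is `norm_inner_homPart_le`.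

The joint numerical radius lives on another Fock space, with one generator per word of length `k`.
Concatenation embeds that space in `F²(H_n)` and carries its creation operators to the `S_α`, so the
radius is that of `P_k` on an invariant subspace (`coeffRadius_le`).

Summing these bounds gives at most `‖A_(0)‖ + 2 ‖I - A_(0)‖ fejerPoly m r`, and `t_m` is the point
where the increasing function `fejerPoly m` equals `1 / 2`. As `m` grows the Fejér constants
increase to `1`, and `∑_{k ≥ 1} t ^ k = 1 / 2` at `t = 1 / 3`. -/

noncomputable section

namespace BohrPoly

/-! ### Isometries of `ℓ²`-spaces: extension by zero and diagonal operators. -/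

section Extend

variable {X Y Z : Type*}

theorem extend_zero_comp {f : X → Y} {g : Y → Z} (hf : f.Injective) (hg : g.Injective)
    (φ : X → ℂ) :
    Function.extend g (Function.extend f φ 0) 0 = Function.extend (g ∘ f) φ 0 := by
  funext z
  by_cases h : ∃ y, g y = z
  · obtain ⟨y, rfl⟩ := h
    rw [hg.extend_apply]
    by_cases h' : ∃ x, f x = y
    · obtain ⟨x, rfl⟩ := h'
      rw [hf.extend_apply]
      exact ((hg.comp hf).extend_apply φ 0 x).symm
    · rw [Function.extend_apply' _ _ _ h', Function.extend_apply']
      · rfl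
      · rintro ⟨x, hx⟩
        exact h' ⟨x, hg hx⟩
  · rw [Function.extend_apply' _ _ _ h, Function.extend_apply']
    rintro ⟨x, hx⟩
    exact h ⟨f x, hx⟩

theorem extend_norm_sq {f : X → Y} (hf : f.Injective) (φ : X → ℂ) :
    (fun y => ‖Function.extend f φ 0 y‖ ^ (2 : ENNReal).toReal) =
      Function.extend f (fun x => ‖φ x‖ ^ (2 : ENNReal).toReal) 0 := by
  funext y
  by_cases h : ∃ x, f x = y
  · obtain ⟨x, rfl⟩ := h
    simp only [hf.extend_apply]
  · simp only [Function.extend_apply' _ _ _ h]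
    simp

/-- Extension by zero along an injective map, as an isometry of `ℓ²`-spaces. -/
def extendIsometry (f : X → Y) (hf : f.Injective) :
    lp (fun _ : X => ℂ) 2 →ₗᵢ[ℂ] lp (fun _ : Y => ℂ) 2 where
  toFun φ := ⟨Function.extend f φ 0, by
    apply memℓp_gen
    rw [extend_norm_sq hf]
    exact ((hasSum_extend_zero hf).2
      ((memℓp_gen_iff (by norm_num)).1 (lp.memℓp φ)).hasSum).summable⟩
  map_add' φ ψ := Subtype.ext <| by
    have h := Function.extend_add f (φ : X → ℂ) (ψ : X → ℂ) (0 : Y → ℂ) 0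
    rw [add_zero] at h
    exact h
  map_smul' c φ := Subtype.ext <| by
    have h := Function.extend_smul c f (φ : X → ℂ) (0 : Y → ℂ)
    rw [smul_zero] at h
    exact h
  norm_map' φ := by
    have h2 : 0 < (2 : ENNReal).toReal := by norm_num
    rw [lp.norm_eq_tsum_rpow h2, lp.norm_eq_tsum_rpow h2]
    congr 1
    change ∑' γ, ‖Function.extend f φ 0 γ‖ ^ (2 : ENNReal).toReal = _
    rw [extend_norm_sq hf]
    exact ((hasSum_extend_zero hf).2
      ((memℓp_gen_iff h2).1 (lp.memℓp φ)).hasSum).tsum_eq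

theorem extendIsometry_coe (f : X → Y) (hf : f.Injective) (φ : lp (fun _ : X => ℂ) 2) :
    (extendIsometry f hf φ : Y → ℂ) = Function.extend f φ 0 := rfl

/-- The diagonal operator with unimodular entries `u`, as an isometry of an `ℓ²`-space. -/
def diagIsometry (u : X → Circle) :
    lp (fun _ : X => ℂ) 2 →ₗᵢ[ℂ] lp (fun _ : X => ℂ) 2 where
  toFun φ := ⟨fun x => (u x : ℂ) * φ x, by
    apply memℓp_gen
    simp only [norm_mul, Circle.norm_coe, one_mul]
    exact (memℓp_gen_iff (by norm_num)).1 (lp.memℓp φ)⟩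
  map_add' φ ψ := Subtype.ext (funext fun x => mul_add _ (φ x) (ψ x))
  map_smul' c φ := Subtype.ext (funext fun x => mul_left_comm _ c (φ x))
  norm_map' φ := by
    have h2 : 0 < (2 : ENNReal).toReal := by norm_num
    rw [lp.norm_eq_tsum_rpow h2, lp.norm_eq_tsum_rpow h2]
    congr 1
    change ∑' x, ‖(u x : ℂ) * φ x‖ ^ (2 : ENNReal).toReal = _
    simp only [norm_mul, Circle.norm_coe, one_mul]

theorem diagIsometry_apply (u : X → Circle) (φ : lp (fun _ : X => ℂ) 2) (x : X) :
    diagIsometry u φ x = (u x : ℂ) * φ x := rfl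

end Extend

/-! ### Gauge and concatenation isometries of Fock spaces. -/

section FockSpace

variable {ι : Type*}

theorem creation_coe (i : ι) (φ : Fock ι) :
    (creation i φ : FreeMonoid ι → ℂ) = Function.extend (FreeMonoid.of i * ·) φ 0 := rfl

/-- Reduces intertwining relations for `S_α` to relations between injections of words. -/
theorem creationWord_coe (α : FreeMonoid ι) (φ : Fock ι) :
    (creationWord α φ : FreeMonoid ι → ℂ) = Function.extend (α * ·) φ 0 := by
  induction α using FreeMonoid.inductionOn' with
  | one =>
    have h : ((1 : FreeMonoid ι) * · : FreeMonoid ι → FreeMonoid ι) = id := by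
      funext; simp
    rw [h]
    funext x
    rw [map_one]
    exact (Function.injective_id.extend_apply (φ : FreeMonoid ι → ℂ) 0 x).symm
  | of_mul i α ih =>
    rw [map_mul]
    change (creation i (creationWord α φ) : FreeMonoid ι → ℂ) = _
    rw [creation_coe, ih, extend_zero_comp (mul_right_injective α) (of_mul_injective i)]
    rfl

/-- The gauge isometry, multiplying `e_α` by `u ^ (-|α|)`. -/
def gauge (ι : Type*) (u : Circle) : Fock ι →ₗᵢ[ℂ] Fock ι :=
  diagIsometry fun α => (u ^ α.length)⁻¹

/-- Since `|αβ| = |α| + |β|`, the gauge factor after `S_α` has an extra `u ^ (-|α|)`, which the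
scalar cancels. -/
theorem creationWord_comp_gauge (α : FreeMonoid ι) (u : Circle) :
    creationWord α ∘L (gauge ι u).toContinuousLinearMap =
      (gauge ι u).toContinuousLinearMap ∘L ((u : ℂ) ^ α.length • creationWord α) := by
  ext φ γ
  change creationWord α (gauge ι u φ) γ = gauge ι u ((u : ℂ) ^ α.length • creationWord α φ) γ
  rw [creationWord_coe, gauge, diagIsometry_apply, lp.coeFn_smul, Pi.smul_apply, creationWord_coe]
  by_cases h : ∃ β, α * β = γ
  · obtain ⟨β, rfl⟩ := h
    have hi : Function.Injective (α * · : FreeMonoid ι → FreeMonoid ι) := mul_right_injective α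
    rw [hi.extend_apply _ _ β, hi.extend_apply _ _ β, diagIsometry_apply]
    have hu : (u : ℂ) ≠ 0 := u.coe_ne_zero
    simp only [FreeMonoid.length_mul, pow_add, Circle.coe_inv, Circle.coe_mul, Circle.coe_pow,
      smul_eq_mul]
    field_simp
  · rw [Function.extend_apply' _ _ _ h, Function.extend_apply' _ _ _ h]
    simp

theorem length_word {k : ℕ} (i : Fin k → ι) : (word i).length = k := by
  simp [word, FreeMonoid.length, FreeMonoid.toList_ofList]

theorem word_mul_inj {k : ℕ} {i j : Fin k → ι} {α β : FreeMonoid ι}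
    (h : word i * α = word j * β) : i = j ∧ α = β := by
  have h' : List.ofFn i ++ α.toList = List.ofFn j ++ β.toList := h
  obtain ⟨h1, h2⟩ := List.append_inj h' (by simp)
  exact ⟨List.ofFn_injective h1, h2⟩

/-- A word in words of length `k` is determined by its concatenation. -/
theorem lift_word_injective {k : ℕ} (hk : k ≠ 0) :
    Function.Injective (FreeMonoid.lift (word : (Fin k → ι) → FreeMonoid ι)) := by
  -- For `k = 0` every block is the empty word and decoding fails.
  have key : ∀ (i : Fin k → ι) (β : FreeMonoid ι), word i * β ≠ 1 := by
    intro i β h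
    have := congrArg FreeMonoid.length h
    simp [FreeMonoid.length_mul, length_word, hk] at this
  intro α
  induction α using FreeMonoid.inductionOn' with
  | one =>
    intro β h
    induction β using FreeMonoid.inductionOn' with
    | one => rfl
    | of_mul j β _ =>
      rw [map_one, map_mul, FreeMonoid.lift_eval_of] at h
      exact absurd h.symm (key _ _)
  | of_mul i α ih =>
    intro β h
    induction β using FreeMonoid.inductionOn' with
    | one =>
      rw [map_one, map_mul, FreeMonoid.lift_eval_of] at h
      exact absurd h (key _ _)
    | of_mul j β _ =>
      rw [map_mul, map_mul, FreeMonoid.lift_eval_of, FreeMonoid.lift_eval_of] at h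
      obtain ⟨h1, h2⟩ := word_mul_inj h
      rw [h1, ih h2]

/-- The embedding of the Fock space over the words of length `k` that concatenates words. -/
def concatIsometry (ι : Type*) {k : ℕ} (hk : k ≠ 0) : Fock (Fin k → ι) →ₗᵢ[ℂ] Fock ι :=
  extendIsometry (FreeMonoid.lift word) (lift_word_injective hk)

theorem creationWord_comp_concat {k : ℕ} (hk : k ≠ 0) (i : Fin k → ι) :
    creationWord (word i) ∘L (concatIsometry ι hk).toContinuousLinearMap =
      (concatIsometry ι hk).toContinuousLinearMap ∘L creation i := by
  refine ContinuousLinearMap.ext fun φ => Subtype.ext ?_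
  change (creationWord (word i) (concatIsometry ι hk φ) : FreeMonoid ι → ℂ) =
    (concatIsometry ι hk (creation i φ) : FreeMonoid ι → ℂ)
  rw [creationWord_coe, concatIsometry, extendIsometry_coe, extendIsometry_coe, creation_coe,
    extend_zero_comp (lift_word_injective hk) (mul_right_injective (word i)),
    extend_zero_comp (of_mul_injective i) (lift_word_injective hk)]
  congr 1
  funext β
  simp [FreeMonoid.lift_eval_of]

theorem norm_creation_le (i : ι) : ‖creation i‖ ≤ 1 :=
  (creationIsometry i).norm_toContinuousLinearMap_le

end FockSpace

/-! ### Operators and isometries on Hilbert tensor products. -/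

section Tensor

variable {E F H : Type*} [NormedAddCommGroup E] [InnerProductSpace ℂ E]
  [NormedAddCommGroup F] [InnerProductSpace ℂ F] [NormedAddCommGroup H] [InnerProductSpace ℂ H]

/-- The isometry `U ⊗ 1` of Hilbert tensor products. -/
def isoTensor (H : Type*) [NormedAddCommGroup H] [InnerProductSpace ℂ H] (U : E →ₗᵢ[ℂ] F) :
    HilbertTensor E H →ₗᵢ[ℂ] HilbertTensor F H where
  toLinearMap := ((U.rTensor H).toContinuousLinearMap.completion).toLinearMap
  norm_map' x := by
    induction x using UniformSpace.Completion.induction_on with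
    | hp => exact isClosed_eq (by simpa using by fun_prop) (by fun_prop)
    | ih a =>
      change ‖(U.rTensor H).toContinuousLinearMap.completion a‖ = _
      rw [ContinuousLinearMap.completion_apply_coe, UniformSpace.Completion.norm_coe,
        UniformSpace.Completion.norm_coe]
      exact (U.rTensor H).norm_map a

theorem isoTensor_coe (U : E →ₗᵢ[ℂ] F) (x : E ⊗[ℂ] H) :
    isoTensor H U (x : HilbertTensor E H) = ((U.rTensor H x : F ⊗[ℂ] H) : HilbertTensor F H) :=
  ContinuousLinearMap.completion_apply_coe _ _

theorem opTensor_coe (T : E →L[ℂ] E) (A : H →L[ℂ] H) (x : E ⊗[ℂ] H) :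
    opTensor T A (x : HilbertTensor E H) = (TensorProduct.mapL T A x : E ⊗[ℂ] H) :=
  ContinuousLinearMap.completion_apply_coe _ _

/-- An isometry intertwining `T` and `T'` gives one intertwining `T ⊗ A` and `T' ⊗ A`. -/
theorem opTensor_isoTensor {U : E →ₗᵢ[ℂ] F} {T : F →L[ℂ] F} {T' : E →L[ℂ] E}
    (h : T ∘L U.toContinuousLinearMap = U.toContinuousLinearMap ∘L T') (A : H →L[ℂ] H)
    (x : HilbertTensor E H) :
    opTensor T A (isoTensor H U x) = isoTensor H U (opTensor T' A x) := by
  -- Both sides are continuous, so simple tensors suffice.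
  induction x using UniformSpace.Completion.induction_on with
  | hp =>
    exact isClosed_eq ((opTensor T A).continuous.comp (isoTensor H U).continuous)
      ((isoTensor H U).continuous.comp (opTensor T' A).continuous)
  | ih a =>
    rw [isoTensor_coe, opTensor_coe, opTensor_coe, isoTensor_coe]
    congr 1
    induction a with
    | zero => simp
    | add a b ha hb => simp only [map_add, ha, hb]
    | tmul e y =>
      have := congrArg (fun f => f e ⊗ₜ[ℂ] A y) h
      simpa using this

theorem opTensor_smul_left (c : ℂ) (T : E →L[ℂ] E) (A : H →L[ℂ] H) (x : HilbertTensor E H) :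
    opTensor (c • T) A x = c • opTensor T A x := by
  induction x using UniformSpace.Completion.induction_on with
  | hp =>
    exact isClosed_eq (opTensor (c • T) A).continuous
      ((opTensor T A).continuous.const_smul c)
  | ih a =>
    rw [opTensor_coe, opTensor_coe, TensorProduct.mapL_smul_left,
      ← UniformSpace.Completion.coe_smul]
    rfl

theorem norm_opTensor_apply_le (T : E →L[ℂ] E) (A : H →L[ℂ] H) (x : HilbertTensor E H) :
    ‖opTensor T A x‖ ≤ ‖T‖ * ‖A‖ * ‖x‖ := by
  induction x using UniformSpace.Completion.induction_on with
  | hp =>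
    exact isClosed_le (opTensor T A).continuous.norm (continuous_const.mul continuous_norm)
  | ih a =>
    rw [opTensor_coe, UniformSpace.Completion.norm_coe, UniformSpace.Completion.norm_coe]
    exact (ContinuousLinearMap.le_opNorm _ _).trans
      (mul_le_mul_of_nonneg_right (TensorProduct.norm_mapL_le T A) (norm_nonneg _))

theorem opTensor_one_sub (A : H →L[ℂ] H) (x : HilbertTensor E H) :
    opTensor (1 : E →L[ℂ] E) (1 - A) x = x - opTensor (1 : E →L[ℂ] E) A x := by
  induction x using UniformSpace.Completion.induction_on with
  | hp =>
    exact isClosed_eq (opTensor _ _).continuous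
      (continuous_id.sub (opTensor _ _).continuous)
  | ih a =>
    rw [opTensor_coe, opTensor_coe, ← UniformSpace.Completion.coe_sub]
    congr 1
    induction a with
    | zero => simp
    | add a b ha hb => rw [map_add, map_add, ha, hb]; abel
    | tmul e y => simp [TensorProduct.tmul_sub]

end Tensor

/-! ### The Egerváry–Szász inequality by discrete Fourier sums. -/

theorem sum_pow_eq_zero_of_pow_eq_one {w : ℂ} {L : ℕ} (hw : w ^ L = 1) (h1 : w ≠ 1) :
    ∑ j ∈ Finset.range L, w ^ j = 0 := by
  rw [geom_sum_eq h1, hw, sub_self, zero_div]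

theorem cexp_sum_eq_zero {L : ℕ} (hL : L ≠ 0) {l : ℤ} (hl : l ≠ 0) (hlL : |l| < L) (a : ℂ) :
    ∑ j ∈ Finset.range L,
      Complex.exp (l * ((2 * (j : ℂ) + 1) * Real.pi / L + a) * Complex.I) = 0 := by
  have hL' : (L : ℂ) ≠ 0 := by exact_mod_cast hL
  set w : ℂ := Complex.exp (l * (2 * Real.pi / L) * Complex.I) with hw
  have hwL : w ^ L = 1 := by
    rw [hw, ← Complex.exp_nat_mul, Complex.exp_eq_one_iff]
    exact ⟨l, by field_simp⟩
  have hw1 : w ≠ 1 := by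
    rw [hw, Ne, Complex.exp_eq_one_iff]
    rintro ⟨n, hn⟩
    have hpi : (Real.pi : ℂ) ≠ 0 := by exact_mod_cast Real.pi_ne_zero
    have h2 : (l : ℂ) = n * L := by
      field_simp at hn
      linear_combination hn
    have h3 : l = n * L := by exact_mod_cast h2
    rcases eq_or_ne n 0 with rfl | hn0
    · simp at h3; exact hl h3
    · have : (1 : ℤ) ≤ |n| := Int.one_le_abs hn0
      rw [h3, abs_mul, Nat.abs_cast] at hlL
      nlinarith
  have : ∀ j : ℕ, Complex.exp (l * ((2 * (j : ℂ) + 1) * Real.pi / L + a) * Complex.I) =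
      Complex.exp (l * (Real.pi / L + a) * Complex.I) * w ^ j := by
    intro j
    rw [hw, ← Complex.exp_nat_mul, ← Complex.exp_add]
    congr 1
    ring
  simp only [this]
  rw [← Finset.mul_sum, sum_pow_eq_zero_of_pow_eq_one hwL hw1, mul_zero]

/-- Among the odd multiples of `π / N`, the multiple `1` has the largest cosine. -/
theorem cos_odd_mul_le {N : ℕ} (hN : 2 ≤ N) (j : ℕ) :
    Real.cos ((2 * (j : ℝ) + 1) * (Real.pi / N)) ≤ Real.cos (Real.pi / N) := by
  have hN0 : (0 : ℝ) < N := by positivity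
  have hr : j % N < N := Nat.mod_lt _ (by omega)
  set r := j % N with hrdef
  have e : (2 * (j : ℝ) + 1) * (Real.pi / N) =
      (2 * (r : ℝ) + 1) * (Real.pi / N) + (j / N : ℕ) * (2 * Real.pi) := by
    have : (j : ℝ) = N * (j / N : ℕ) + r := by
      exact_mod_cast (Nat.div_add_mod j N).symm
    rw [this]
    field_simp
    ring
  rw [e, Real.cos_add_nat_mul_two_pi]
  have hp := Real.pi_pos
  have hd : 0 < Real.pi / N := by positivity
  have hNd : N * (Real.pi / N) = Real.pi := by field_simp
  have hrN : (r : ℝ) + 1 ≤ N := by exact_mod_cast hr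
  have hr0 : (0 : ℝ) ≤ r := by positivity
  have hN2 : (2 : ℝ) ≤ N := by exact_mod_cast hN
  rcases le_or_gt ((2 * (r : ℝ) + 1) * (Real.pi / N)) Real.pi with h | h
  · exact Real.cos_le_cos_of_nonneg_of_le_pi hd.le h (by nlinarith)
  -- Reflecting in `π` brings the angle back into `[π / N, π]`.
  · rw [← Real.cos_two_pi_sub]
    refine Real.cos_le_cos_of_nonneg_of_le_pi hd.le (by linarith) ?_
    nlinarith

/-- The Egerváry–Szász inequality for the coefficients of a nonnegative trigonometric
polynomial. -/
theorem fejer_coeff_le {m k N : ℕ} (hk : 1 ≤ k) (hkm : k < m) (hN : 3 ≤ N) (hmN : m ≤ k * (N - 1))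
    {c₀ : ℝ} {c : ℕ → ℂ}
    (h : ∀ u : Circle, 0 ≤ c₀ + ∑ j ∈ Finset.Ico 1 m, ((u : ℂ) ^ j * c j).re) :
    ‖c k‖ ≤ 2 * c₀ * Real.cos (Real.pi / N) := by
  set L := k * N with hL
  have hL0 : L ≠ 0 := by positivity
  have hLpos : (0 : ℝ) < L := by positivity
  have hkC : (k : ℂ) ≠ 0 := by exact_mod_cast (by omega : k ≠ 0)
  -- With this `L`, the frequencies `l + k` for `l < m` do not alias to zero.
  have hmL : m + k ≤ L := by
    obtain ⟨N', rfl⟩ : ∃ N', N = N' + 1 := ⟨N - 1, by omega⟩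
    simp only [Nat.add_sub_cancel] at hmN
    rw [hL, mul_add]; omega
  have hcos : 0 < Real.cos (Real.pi / N) := by
    apply Real.cos_pos_of_mem_Ioo
    have h3 : (3 : ℝ) ≤ N := by exact_mod_cast hN
    have : Real.pi / N ≤ Real.pi / 3 := by gcongr
    have hp := Real.pi_pos
    have : 0 < Real.pi / N := by positivity
    constructor <;> linarith
  set b := Real.cos (Real.pi / N) with hb
  -- Rotation by `a` turns the `k`-th coefficient into `‖c k‖`.
  set a : ℝ := -(Complex.arg (c k)) / k with ha
  -- The nodes are arguments of the `L`-th roots of `-1`, so `k θ_j` is an odd multiple of `π / N`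
  -- and the weights below are nonnegative.
  set θ : ℕ → ℝ := fun j => (2 * (j : ℝ) + 1) * Real.pi / L with hθ
  set w : ℕ → ℝ := fun j => b - Real.cos (k * θ j) with hw
  have hkθ : ∀ j, k * θ j = (2 * (j : ℝ) + 1) * (Real.pi / N) := by
    intro j
    have : (k : ℝ) ≠ 0 := by exact_mod_cast (by omega : k ≠ 0)
    simp only [hθ, hL]
    push_cast
    field_simp
  have hw0 : ∀ j, 0 ≤ w j := fun j => by
    have := cos_odd_mul_le (N := N) (by omega) j
    simp only [hw, hkθ]
    linarith
  have hz : ∀ (l : ℤ) (x : ℂ), l ≠ 0 → |l| < L →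
      ∑ j ∈ Finset.range L, x * Complex.exp (l * θ j * Complex.I) = 0 := by
    intro l x hl hlL
    rw [← Finset.mul_sum]
    have := cexp_sum_eq_zero hL0 hl hlL 0
    simp only [add_zero] at this
    simp only [hθ]
    push_cast
    rw [this, mul_zero]
  have hwexp : ∀ j (l : ℤ), (w j : ℂ) * Complex.exp (l * θ j * Complex.I) =
      (b : ℂ) * Complex.exp (l * θ j * Complex.I)
        - (2⁻¹ * Complex.exp ((l + k : ℤ) * θ j * Complex.I)
          + 2⁻¹ * Complex.exp ((l - k : ℤ) * θ j * Complex.I)) := by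
    intro j l
    have e1 : Complex.exp ((l + k : ℤ) * θ j * Complex.I) =
        Complex.exp (l * θ j * Complex.I) * Complex.exp (k * θ j * Complex.I) := by
      rw [← Complex.exp_add]; push_cast; congr 1; ring
    have e2 : Complex.exp ((l - k : ℤ) * θ j * Complex.I) =
        Complex.exp (l * θ j * Complex.I) * Complex.exp (-(k * θ j) * Complex.I) := by
      rw [← Complex.exp_add]; push_cast; congr 1; ring
    rw [e1, e2]
    simp only [hw]
    push_cast
    rw [Complex.cos]
    ring
  -- The factor `cos (k θ_j)` shifts the frequency by `±k`; orthogonality leaves only `l = 0` and `l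
  -- = k`.
  have hmoment : ∀ l : ℕ, l + k < L → ∑ j ∈ Finset.range L, (w j : ℂ) *
      Complex.exp ((l : ℤ) * θ j * Complex.I) =
        if l = 0 then (L * b : ℂ) else if l = k then -(L : ℂ) / 2 else 0 := by
    intro l hl
    simp only [hwexp, Finset.sum_sub_distrib, Finset.sum_add_distrib]
    rw [hz (l + k) _ (by omega) (by rw [abs_lt]; constructor <;> omega)]
    split_ifs with h0 h1
    · subst h0
      rw [hz ((0 : ℕ) - k) _ (by omega) (by rw [abs_lt]; constructor <;> omega)]
      simp
    · subst h1
      rw [hz _ _ (by omega) (by rw [abs_lt]; constructor <;> omega)]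
      simp
      ring
    · rw [hz _ _ (by omega) (by rw [abs_lt]; constructor <;> omega),
        hz _ _ (by omega) (by rw [abs_lt]; constructor <;> omega)]
      simp
  have hpos : 0 ≤ ∑ j ∈ Finset.range L, w j * (c₀ + ∑ l ∈ Finset.Ico 1 m,
      ((Circle.exp (θ j + a) : ℂ) ^ l * c l).re) :=
    Finset.sum_nonneg fun j _ => mul_nonneg (hw0 j) (h _)
  have hsum0 : ∑ j ∈ Finset.range L, w j = L * b := by
    have := hmoment 0 (by omega)
    simp only [Nat.cast_zero, Int.cast_zero, zero_mul, Complex.exp_zero, mul_one, if_true] at this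
    exact_mod_cast this
  have hcomp : ∑ j ∈ Finset.range L, w j * (c₀ + ∑ l ∈ Finset.Ico 1 m,
      ((Circle.exp (θ j + a) : ℂ) ^ l * c l).re) = L * b * c₀ - L / 2 * ‖c k‖ := by
    have hl : ∀ l ∈ Finset.Ico 1 m, ∑ j ∈ Finset.range L,
        w j * ((Circle.exp (θ j + a) : ℂ) ^ l * c l).re =
          if l = k then - (L / 2 * ‖c k‖) else 0 := by
      intro l hl
      obtain ⟨hl1, hl2⟩ := Finset.mem_Ico.1 hl
      have e : ∀ j, w j * ((Circle.exp (θ j + a) : ℂ) ^ l * c l).re =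
          (((w j : ℂ) * Complex.exp ((l : ℤ) * θ j * Complex.I)) *
            (Complex.exp (l * a * Complex.I) * c l)).re := by
        intro j
        rw [← Complex.re_ofReal_mul, Circle.coe_exp, ← Complex.exp_nat_mul]
        have : Complex.exp (l * ((θ j + a : ℝ) * Complex.I)) =
          Complex.exp ((l : ℤ) * θ j * Complex.I) * Complex.exp (l * a * Complex.I) := by
          rw [← Complex.exp_add]; push_cast; congr 1; ring
        rw [this]
        congr 1
        ring
      simp only [e]
      rw [← Complex.re_sum, ← Finset.sum_mul, hmoment l (by omega), if_neg (by omega)]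
      split_ifs with hlk
      · subst hlk
        have : Complex.exp (l * a * Complex.I) * c l = (‖c l‖ : ℂ) := by
          conv_lhs => rw [← Complex.norm_mul_exp_arg_mul_I (c l)]
          rw [mul_left_comm, ← Complex.exp_add]
          have : (l : ℂ) * a * Complex.I + Complex.arg (c l) * Complex.I = 0 := by
            rw [ha]; push_cast; field_simp; ring
          rw [this, Complex.exp_zero, mul_one]
        rw [this]
        have : -(L : ℂ) / 2 * (‖c l‖ : ℂ) = ((-(L / 2 * ‖c l‖) : ℝ) : ℂ) := by
          push_cast; ring
        rw [this, Complex.ofReal_re]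
      · simp
    simp only [mul_add, Finset.sum_add_distrib, Finset.mul_sum]
    rw [Finset.sum_comm, Finset.sum_congr rfl hl, Finset.sum_ite_eq', if_pos (by simp; omega),
      ← Finset.sum_mul, hsum0]
    ring
  rw [hcomp] at hpos
  have : 0 ≤ (L : ℝ) * (b * c₀ - ‖c k‖ / 2) := by linarith
  have := nonneg_of_mul_nonneg_right this hLpos
  linarith

/-! ### The Fejér constants and the roots `t_m`. -/

theorem fejerConst_eq (m k : ℕ) (hm : 1 ≤ m) :
    fejerConst m k = Real.cos (Real.pi / (((m - 1) / k + 2 : ℕ) : ℝ)) := by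
  have : ⌊((m : ℝ) - 1) / (k : ℝ)⌋ = (((m - 1) / k : ℕ) : ℤ) := by
    rw [← Nat.floor_div_eq_div (K := ℝ), Nat.cast_sub hm, Nat.cast_one,
      Int.natCast_floor_eq_floor]
    have : (1 : ℝ) ≤ m := by exact_mod_cast hm
    exact div_nonneg (by linarith) (by positivity)
  rw [fejerConst, this]
  push_cast
  rfl

theorem cos_pi_div_mono {a b : ℕ} (ha : 1 ≤ a) (hab : a ≤ b) :
    Real.cos (Real.pi / a) ≤ Real.cos (Real.pi / b) := by
  have hp := Real.pi_pos
  have h1 : (1 : ℝ) ≤ a := by exact_mod_cast ha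
  have h2 : (a : ℝ) ≤ b := by exact_mod_cast hab
  apply Real.cos_le_cos_of_nonneg_of_le_pi (by positivity)
  · exact div_le_self hp.le h1
  · gcongr

theorem fejerConst_mono {m m' : ℕ} (hm : 1 ≤ m) (h : m ≤ m') (k : ℕ) :
    fejerConst m k ≤ fejerConst m' k := by
  rw [fejerConst_eq m k hm, fejerConst_eq m' k (hm.trans h)]
  exact cos_pi_div_mono (Nat.le_add_left 1 _) (by gcongr)

theorem fejerConst_nonneg {m : ℕ} (hm : 1 ≤ m) (k : ℕ) : 0 ≤ fejerConst m k := by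
  rw [fejerConst_eq m k hm]
  have := cos_pi_div_mono (a := 2) (b := (m - 1) / k + 2) (by omega) (Nat.le_add_left 2 _)
  simpa using this

theorem half_le_fejerConst {m k : ℕ} (hk : 1 ≤ k) (hkm : k ≤ m - 1) :
    1 / 2 ≤ fejerConst m k := by
  rw [fejerConst_eq m k (by omega)]
  have h1 : 1 ≤ (m - 1) / k := (Nat.one_le_div_iff (by omega)).2 hkm
  have := cos_pi_div_mono (a := 3) (b := (m - 1) / k + 2) (by omega) (by omega)
  simpa using this

theorem fejerConst_le_one (m k : ℕ) : fejerConst m k ≤ 1 := Real.cos_le_one _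

theorem tendsto_fejerConst {k : ℕ} (hk : 1 ≤ k) :
    Filter.Tendsto (fun m => fejerConst m k) Filter.atTop (nhds 1) := by
  have h1 : Filter.Tendsto (fun m : ℕ => (m - 1) / k + 2) Filter.atTop Filter.atTop :=
    Filter.tendsto_add_atTop_nat 2 |>.comp
      ((Nat.tendsto_div_const_atTop (by omega : k ≠ 0)).comp (Filter.tendsto_sub_atTop_nat 1))
  have h2 := (Real.continuous_cos.tendsto 0).comp
    ((tendsto_const_div_atTop_nhds_zero_nat Real.pi).comp h1)
  rw [Real.cos_zero] at h2
  refine h2.congr' ?_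
  filter_upwards [Filter.eventually_ge_atTop 1] with m hm
  rw [fejerConst_eq m k hm]
  rfl

/-- The polynomial `∑ t ^ k cos (π / ([(m-1)/k] + 2))`. -/
def fejerPoly (m : ℕ) (t : ℝ) : ℝ := ∑ k ∈ Finset.Icc 1 (m - 1), t ^ k * fejerConst m k

theorem fejerPoly_strictMonoOn {m : ℕ} (hm : 2 ≤ m) :
    StrictMonoOn (fejerPoly m) (Set.Ici 0) := by
  intro s hs t _ hst
  have hs : (0 : ℝ) ≤ s := hs
  refine Finset.sum_lt_sum_of_nonempty ⟨1, by simp; omega⟩ fun k hk => ?_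
  obtain ⟨h1, h2⟩ := Finset.mem_Icc.1 hk
  exact mul_lt_mul_of_pos_right (pow_lt_pow_left₀ hst hs (by omega))
    (lt_of_lt_of_le (by norm_num) (half_le_fejerConst h1 h2))

theorem fejerPoly_one_ge {m : ℕ} (hm : 2 ≤ m) : 1 / 2 ≤ fejerPoly m 1 := by
  have h1 : (1 : ℕ) ∈ Finset.Icc 1 (m - 1) := by simp; omega
  refine le_trans ?_ (Finset.single_le_sum (f := fun k => (1 : ℝ) ^ k * fejerConst m k)
    (fun k _ => mul_nonneg (by positivity) (fejerConst_nonneg (by omega) k)) h1)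
  simpa using half_le_fejerConst (m := m) (k := 1) le_rfl (by omega)

theorem exists_fejerPoly_eq {m : ℕ} (hm : 2 ≤ m) :
    ∃ t : ℝ, 0 < t ∧ t ≤ 1 ∧ fejerPoly m t = 1 / 2 := by
  have hz : fejerPoly m 0 = 0 :=
    Finset.sum_eq_zero fun k hk => by
      rw [zero_pow (by have := Finset.mem_Icc.1 hk; omega), zero_mul]
  have hc : ContinuousOn (fejerPoly m) (Set.Icc 0 1) := by
    unfold fejerPoly
    fun_prop
  obtain ⟨t, ht, hte⟩ := intermediate_value_Icc zero_le_one hc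
    (⟨by rw [hz]; norm_num, fejerPoly_one_ge hm⟩ : (1 / 2 : ℝ) ∈ Set.Icc (fejerPoly m 0) (fejerPoly m 1))
  refine ⟨t, lt_of_le_of_ne ht.1 ?_, ht.2, hte⟩
  rintro rfl
  rw [hz] at hte
  norm_num at hte

/-- The coefficients do not decrease with `m`, and the new top term is positive. This makes `t_m`
strictly decreasing. -/
theorem fejerPoly_lt {m m' : ℕ} (hm : 1 ≤ m) (h : m < m') {t : ℝ} (ht : 0 < t) :
    fejerPoly m t < fejerPoly m' t := by
  have hsub : Finset.Icc 1 (m - 1) ⊆ Finset.Icc 1 (m' - 1) :=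
    Finset.Icc_subset_Icc_right (by omega)
  refine lt_of_le_of_lt (b := ∑ k ∈ Finset.Icc 1 (m - 1), t ^ k * fejerConst m' k) ?_ ?_
  · exact Finset.sum_le_sum fun k _ =>
      mul_le_mul_of_nonneg_left (fejerConst_mono hm h.le k) (by positivity)
  · refine Finset.sum_lt_sum_of_subset hsub (i := m' - 1) (Finset.mem_Icc.2 ⟨by omega, le_rfl⟩)
      (by simp; omega) ?_ ?_
    · exact mul_pos (by positivity)
        (lt_of_lt_of_le (by norm_num) (half_le_fejerConst (by omega) le_rfl))
    · exact fun k _ _ => mul_nonneg (by positivity) (fejerConst_nonneg (by omega) k)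

theorem sum_Icc_pow_third_lt (n : ℕ) : ∑ k ∈ Finset.Icc 1 n, (1 / 3 : ℝ) ^ k < 1 / 2 := by
  have : ∑ k ∈ Finset.Icc 1 n, (1 / 3 : ℝ) ^ k = 1 / 2 - (1 / 3) ^ n / 2 := by
    induction n with
    | zero => simp
    | succ n ih =>
      rw [Finset.sum_Icc_succ_top (by omega), ih]
      ring
  rw [this]
  have : (0 : ℝ) < (1 / 3) ^ n := by positivity
  linarith

theorem fejerPoly_third_lt (m : ℕ) : fejerPoly m (1 / 3) < 1 / 2 := by
  refine lt_of_le_of_lt (Finset.sum_le_sum fun k _ => ?_) (sum_Icc_pow_third_lt (m - 1))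
  exact mul_le_of_le_one_right (by positivity) (fejerConst_le_one m k)

/-- For `s < 1` the geometric series exceeds `1 / 2`, hence so does a partial sum; on those finitely
many terms the constants tend to `1`. -/
theorem eventually_half_lt_fejerPoly {s : ℝ} (hs : 1 / 3 < s) :
    ∀ᶠ m in Filter.atTop, 1 / 2 < fejerPoly m s := by
  wlog hs1 : s < 1 generalizing s
  · filter_upwards [this (s := 1 / 2) (by norm_num) (by norm_num),
      Filter.eventually_ge_atTop 2] with m hm hm2
    refine hm.trans (fejerPoly_strictMonoOn hm2 ?_ ?_ ?_)
    · simp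
    · simp only [Set.mem_Ici]; linarith
    · linarith
  have hs0 : 0 < s := by linarith
  obtain ⟨K, hK⟩ : ∃ K : ℕ, 1 / 2 < ∑ k ∈ Finset.Icc 1 K, s ^ k := by
    have h := (hasSum_geometric_of_lt_one hs0.le hs1).tendsto_sum_nat
    -- The threshold is `1 / 2` plus the term `k = 0`, removed below.
    have h32 : 3 / 2 < (1 - s)⁻¹ := by
      rw [lt_inv_comm₀ (by norm_num) (by linarith)]
      norm_num
      linarith
    obtain ⟨N, hN, hN1⟩ := ((h.eventually (lt_mem_nhds h32)).and
      (Filter.eventually_ge_atTop 1)).exists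
    refine ⟨N - 1, ?_⟩
    obtain ⟨K, rfl⟩ : ∃ K, N = K + 1 := ⟨N - 1, by omega⟩
    rw [Finset.sum_range_succ', pow_zero] at hN
    rw [Finset.range_eq_Ico, Finset.sum_Ico_add' (fun k => s ^ k)] at hN
    change 1 / 2 < ∑ k ∈ Finset.Ico (0 + 1) (K + 1), s ^ k
    linarith
  have hlim : Filter.Tendsto (fun m => ∑ k ∈ Finset.Icc 1 K, s ^ k * fejerConst m k)
      Filter.atTop (nhds (∑ k ∈ Finset.Icc 1 K, s ^ k * 1)) :=
    tendsto_finsetSum _ fun k hk =>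
      (tendsto_fejerConst (Finset.mem_Icc.1 hk).1).const_mul _
  simp only [mul_one] at hlim
  filter_upwards [hlim.eventually (lt_mem_nhds hK), Filter.eventually_ge_atTop (K + 1)]
    with m hm hKm
  refine lt_of_lt_of_le hm (Finset.sum_le_sum_of_subset_of_nonneg
    (Finset.Icc_subset_Icc_right (by omega)) fun k _ _ =>
      mul_nonneg (by positivity) (fejerConst_nonneg (by omega) k))

theorem exists_fejerRoots :
    ∃ t : ℕ → ℝ,
      (∀ m : ℕ, 2 ≤ m →
        0 < t m ∧ t m ≤ 1 ∧
        fejerPoly m (t m) = 1 / 2 ∧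
        ∀ s : ℝ, 0 < s → s ≤ 1 → fejerPoly m s = 1 / 2 → s = t m) ∧
      StrictAntiOn t (Set.Ici 2) ∧
      Filter.Tendsto t Filter.atTop (nhds (1 / 3)) := by
  have hex : ∀ m : ℕ, ∃ t : ℝ, 2 ≤ m → 0 < t ∧ t ≤ 1 ∧ fejerPoly m t = 1 / 2 := fun m => by
    by_cases hm : 2 ≤ m
    · obtain ⟨t, ht⟩ := exists_fejerPoly_eq hm
      exact ⟨t, fun _ => ht⟩
    · exact ⟨0, fun h => absurd h hm⟩
  choose t ht using hex
  refine ⟨t, fun m hm => ?_, fun a ha b hb hab => ?_, ?_⟩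
  · obtain ⟨h0, h1, h2⟩ := ht m hm
    refine ⟨h0, h1, h2, fun s hs0 _ hs => ?_⟩
    exact (fejerPoly_strictMonoOn hm).injOn hs0.le h0.le (hs.trans h2.symm)
  · have ha : 2 ≤ a := ha
    have hb : 2 ≤ b := hb
    obtain ⟨ha0, -, ha2⟩ := ht a ha
    obtain ⟨hb0, -, hb2⟩ := ht b hb
    rw [← (fejerPoly_strictMonoOn hb).lt_iff_lt hb0.le ha0.le, hb2, ← ha2]
    exact fejerPoly_lt (by omega) hab ha0
  · rw [tendsto_order]
    refine ⟨fun a ha => ?_, fun a ha => ?_⟩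
    · filter_upwards [Filter.eventually_ge_atTop 2] with m hm
      obtain ⟨h0, -, h2⟩ := ht m hm
      refine ha.trans ?_
      rw [← (fejerPoly_strictMonoOn hm).lt_iff_lt (by simp) h0.le, h2]
      exact fejerPoly_third_lt m
    · filter_upwards [eventually_half_lt_fejerPoly ha, Filter.eventually_ge_atTop 2] with m hm hm2
      obtain ⟨h0, -, h2⟩ := ht m hm2
      rw [← (fejerPoly_strictMonoOn hm2).lt_iff_lt h0.le
        (by simp only [Set.mem_Ici]; linarith), h2]
      exact hm

/-! ### Numerical radius and real part. -/

section Numerical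

variable {E : Type*} [NormedAddCommGroup E] [InnerProductSpace ℂ E]

theorem numRadius_le {T : E →L[ℂ] E} {B : ℝ} (hB : 0 ≤ B)
    (h : ∀ x : E, ‖x‖ = 1 → ‖inner ℂ x (T x)‖ ≤ B) : numRadius T ≤ B := by
  -- On the zero space the set is empty and the supremum is `0`, hence the need for `0 ≤ B`.
  refine Real.sSup_le ?_ hB
  rintro _ ⟨x, hx, rfl⟩
  rw [← norm_inner_symm]
  exact h x hx

theorem re_inner_le_of_realPart_le_one [CompleteSpace E] {T : E →L[ℂ] E}
    (h : (realPart T : E →L[ℂ] E) ≤ 1) (x : E) : (inner ℂ x (T x)).re ≤ ‖x‖ ^ 2 := by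
  have h1 := ((ContinuousLinearMap.le_def _ _).1 h).re_inner_nonneg_right x
  rw [realPart_apply_coe] at h1
  have h2 : (inner ℂ x ((star T) x)).re = (inner ℂ x (T x)).re := by
    rw [ContinuousLinearMap.star_eq_adjoint, ContinuousLinearMap.adjoint_inner_right,
      ← inner_conj_symm, Complex.conj_re]
  have h3 : (inner ℂ x (((2 : ℝ)⁻¹ • (T + star T)) x)).re = (inner ℂ x (T x)).re := by
    rw [smul_apply, add_apply, inner_smul_right_eq_smul,
      inner_add_right, Complex.smul_re, Complex.add_re, h2, smul_eq_mul]
    ring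
  rw [sub_apply, inner_sub_right, map_sub, one_apply_eq_self,
    inner_self_eq_norm_sq_to_K] at h1
  have h4 : RCLike.re ((‖x‖ : ℂ) ^ 2) = ‖x‖ ^ 2 := by norm_cast
  change 0 ≤ RCLike.re ((‖x‖ : ℂ) ^ 2) - (inner ℂ x (((2 : ℝ)⁻¹ • (T + star T)) x)).re at h1
  rw [h3, h4] at h1
  linarith

end Numerical

/-! ### Homogeneous parts and the Bohr inequality. -/

variable {n : ℕ} {H : Type*} [NormedAddCommGroup H] [InnerProductSpace ℂ H]

/-- The homogeneous part `∑_{|α|=k} S_α ⊗ A_(α)`. -/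
def homPart (A : FreeMonoid (Fin n) → (H →L[ℂ] H)) (k : ℕ) :
    HilbertTensor (Fock (Fin n)) H →L[ℂ] HilbertTensor (Fock (Fin n)) H :=
  ∑ i : Fin k → Fin n, opTensor (creationWord (word i)) (A (word i))

theorem polyOp_eq_sum_homPart (m : ℕ) (A : FreeMonoid (Fin n) → (H →L[ℂ] H)) :
    polyOp m A = ∑ k ∈ Finset.range m, homPart A k := rfl

theorem homPart_zero (A : FreeMonoid (Fin n) → (H →L[ℂ] H)) :
    homPart A 0 = opTensor 1 (A 1) := by
  have hw : ∀ i : Fin 0 → Fin n, word i = 1 := fun i => by simp [word]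
  simp only [homPart, hw, map_one]
  simp

theorem inner_homPart_gauge (A : FreeMonoid (Fin n) → (H →L[ℂ] H)) (k : ℕ) (u : Circle)
    (x : HilbertTensor (Fock (Fin n)) H) :
    inner ℂ (isoTensor H (gauge (Fin n) u) x) (homPart A k (isoTensor H (gauge (Fin n) u) x)) =
      (u : ℂ) ^ k * inner ℂ x (homPart A k x) := by
  have : homPart A k (isoTensor H (gauge (Fin n) u) x) =
      isoTensor H (gauge (Fin n) u) ((u : ℂ) ^ k • homPart A k x) := by
    simp only [homPart, sum_apply, Finset.smul_sum, map_sum]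
    refine Finset.sum_congr rfl fun i _ => ?_
    rw [opTensor_isoTensor (creationWord_comp_gauge (word i) u), opTensor_smul_left, length_word]
  rw [this, LinearIsometry.inner_map_map, inner_smul_right]

theorem norm_inner_homPart_le {m k : ℕ} (hk : 1 ≤ k) (hkm : k ≤ m - 1)
    {A : FreeMonoid (Fin n) → (H →L[ℂ] H)}
    (hA : (realPart (polyOp m A) :
      HilbertTensor (Fock (Fin n)) H →L[ℂ] HilbertTensor (Fock (Fin n)) H) ≤ 1)
    (x : HilbertTensor (Fock (Fin n)) H) :
    ‖inner ℂ x (homPart A k x)‖ ≤ 2 * ‖1 - A 1‖ * fejerConst m k * ‖x‖ ^ 2 := by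
  have hm : 1 ≤ m := by omega
  set c₀ : ℝ := ‖x‖ ^ 2 - (inner ℂ x (homPart A 0 x)).re with hc₀
  -- The real-part bound at the gauge-rotated vector; the norm and the degree-zero term do not
  -- depend on `u`.
  have hpos : ∀ u : Circle, 0 ≤ c₀ +
      ∑ j ∈ Finset.Ico 1 m, ((u : ℂ) ^ j * -inner ℂ x (homPart A j x)).re := by
    intro u
    have h := re_inner_le_of_realPart_le_one hA (isoTensor H (gauge (Fin n) u) x)
    rw [LinearIsometry.norm_map, polyOp_eq_sum_homPart, sum_apply, inner_sum,
      Complex.re_sum] at h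
    simp only [inner_homPart_gauge] at h
    rw [Finset.range_eq_Ico, Finset.sum_eq_sum_Ico_succ_bot (by omega)] at h
    simp only [pow_zero, one_mul, zero_add] at h
    simp only [mul_neg, Complex.neg_re, Finset.sum_neg_distrib, hc₀]
    linarith
  have hq : 1 ≤ (m - 1) / k := (Nat.one_le_div_iff (by omega)).2 hkm
  have hN : m ≤ k * ((m - 1) / k + 2 - 1) := by
    have := Nat.lt_mul_div_succ (m - 1) (by omega : 0 < k)
    rw [show (m - 1) / k + 2 - 1 = (m - 1) / k + 1 by omega]
    omega
  have h := fejer_coeff_le hk (by omega) (by omega) hN hpos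
  rw [norm_neg, ← fejerConst_eq m k hm] at h
  have hc : c₀ ≤ ‖1 - A 1‖ * ‖x‖ ^ 2 := by
    have e : c₀ = (inner ℂ x (opTensor 1 (1 - A 1) x)).re := by
      rw [opTensor_one_sub, inner_sub_right, inner_self_eq_norm_sq_to_K, hc₀, homPart_zero,
        Complex.sub_re]
      norm_cast
    rw [e]
    refine (Complex.re_le_norm _).trans ((norm_inner_le_norm _ _).trans ?_)
    have h1 := norm_opTensor_apply_le (1 : Fock (Fin n) →L[ℂ] Fock (Fin n)) (1 - A 1) x
    have h2 : ‖(1 : Fock (Fin n) →L[ℂ] Fock (Fin n))‖ ≤ 1 := ContinuousLinearMap.norm_id_le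
    calc ‖x‖ * ‖opTensor 1 (1 - A 1) x‖
        ≤ ‖x‖ * (1 * ‖1 - A 1‖ * ‖x‖) := by gcongr; exact h1.trans (by gcongr)
      _ = ‖1 - A 1‖ * ‖x‖ ^ 2 := by ring
  calc _ ≤ 2 * c₀ * fejerConst m k := h
    _ ≤ 2 * (‖1 - A 1‖ * ‖x‖ ^ 2) * fejerConst m k := by
      have := fejerConst_nonneg hm k
      gcongr
    _ = _ := by ring

variable [CompleteSpace H]

theorem coeffRadius_le {m k : ℕ} (hk : 1 ≤ k) (hkm : k ≤ m - 1)
    {A : FreeMonoid (Fin n) → (H →L[ℂ] H)}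
    (hA : (realPart (polyOp m A) :
      HilbertTensor (Fock (Fin n)) H →L[ℂ] HilbertTensor (Fock (Fin n)) H) ≤ 1) :
    coeffRadius A k ≤ 2 * ‖1 - A 1‖ * fejerConst m k := by
  have hk0 : k ≠ 0 := by omega
  refine numRadius_le (mul_nonneg (by positivity) (fejerConst_nonneg (by omega) k)) fun x hx => ?_
  -- The embedding intertwines the operator defining the joint radius with `P_k`, so unit vectors
  -- can be tested in `F²(H_n) ⊗ H`.
  have e : homPart A k (isoTensor H (concatIsometry (Fin n) hk0) x) =
      isoTensor H (concatIsometry (Fin n) hk0) ((∑ i : Fin k → Fin n, opTensor (creation i)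
        (ContinuousLinearMap.adjoint (ContinuousLinearMap.adjoint (A (word i))))) x) := by
    simp only [homPart, sum_apply, map_sum,
      ContinuousLinearMap.adjoint_adjoint]
    exact Finset.sum_congr rfl fun i _ =>
      opTensor_isoTensor (creationWord_comp_concat hk0 i) (A (word i)) x
  have h := norm_inner_homPart_le hk hkm hA (isoTensor H (concatIsometry (Fin n) hk0) x)
  rw [e, LinearIsometry.inner_map_map, LinearIsometry.norm_map, hx, one_pow, mul_one] at h
  exact h

/-- For `k = 0` there is one index, the empty tuple, so the operator is `S ⊗ A_(0)` with a single
isometry `S`, not `I ⊗ A_(0)`. -/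
theorem coeffRadius_zero_le (A : FreeMonoid (Fin n) → (H →L[ℂ] H)) :
    coeffRadius A 0 ≤ ‖A 1‖ := by
  refine numRadius_le (norm_nonneg _) fun x hx => ?_
  have hw : ∀ i : Fin 0 → Fin n, word i = 1 := fun i => by simp [word]
  refine (norm_inner_le_norm _ _).trans ?_
  simp only [hw, ContinuousLinearMap.adjoint_adjoint]
  rw [Fintype.sum_unique, hx, one_mul]
  refine (norm_opTensor_apply_le _ _ _).trans ?_
  rw [hx, mul_one]
  exact mul_le_of_le_one_left (norm_nonneg _) (norm_creation_le _)

theorem sum_coeffRadius_le {m : ℕ} (hm : 2 ≤ m) {A : FreeMonoid (Fin n) → (H →L[ℂ] H)}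
    (hA : (realPart (polyOp m A) :
      HilbertTensor (Fock (Fin n)) H →L[ℂ] HilbertTensor (Fock (Fin n)) H) ≤ 1)
    {r : ℝ} (hr : 0 ≤ r) (hrm : fejerPoly m r ≤ 1 / 2) :
    ∑ k ∈ Finset.range m, r ^ k * coeffRadius A k ≤ ‖A 1‖ + ‖1 - A 1‖ := by
  have hset : Finset.Ico (0 + 1) m = Finset.Icc 1 (m - 1) := by
    ext; simp only [Finset.mem_Ico, Finset.mem_Icc]; omega
  rw [Finset.range_eq_Ico, Finset.sum_eq_sum_Ico_succ_bot (by omega), pow_zero, one_mul, hset]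
  refine add_le_add (coeffRadius_zero_le A) ?_
  calc ∑ k ∈ Finset.Icc 1 (m - 1), r ^ k * coeffRadius A k
      ≤ ∑ k ∈ Finset.Icc 1 (m - 1), r ^ k * (2 * ‖1 - A 1‖ * fejerConst m k) := by
        refine Finset.sum_le_sum fun k hk => ?_
        obtain ⟨h1, h2⟩ := Finset.mem_Icc.1 hk
        exact mul_le_mul_of_nonneg_left (coeffRadius_le h1 h2 hA) (by positivity)
    _ = 2 * ‖1 - A 1‖ * fejerPoly m r := by
        rw [fejerPoly, Finset.mul_sum]
        exact Finset.sum_congr rfl fun k _ => by ring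
    _ ≤ 2 * ‖1 - A 1‖ * (1 / 2) := by gcongr
    _ = ‖1 - A 1‖ := by ring

end BohrPoly

end

theorem theorem2p10 :
    ∃ t : ℕ → ℝ,
      (∀ m : ℕ, 2 ≤ m →
        0 < t m ∧ t m ≤ 1 ∧
        ∑ k ∈ Finset.Icc 1 (m - 1), t m ^ k * BohrPoly.fejerConst m k = 1 / 2 ∧
        ∀ s : ℝ, 0 < s → s ≤ 1 →
          ∑ k ∈ Finset.Icc 1 (m - 1), s ^ k * BohrPoly.fejerConst m k = 1 / 2 → s = t m) ∧
      StrictAntiOn t (Set.Ici 2) ∧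
      Filter.Tendsto t Filter.atTop (nhds (1 / 3)) ∧
      ∀ (n : ℕ) (_ : 1 ≤ n) (H : Type*) [NormedAddCommGroup H] [InnerProductSpace ℂ H]
        [CompleteSpace H] (m : ℕ) (_ : 2 ≤ m) (A : FreeMonoid (Fin n) → (H →L[ℂ] H)),
        0 ≤ A 1 →
        (realPart (BohrPoly.polyOp m A) :
          BohrPoly.HilbertTensor (BohrPoly.Fock (Fin n)) H →L[ℂ]
            BohrPoly.HilbertTensor (BohrPoly.Fock (Fin n)) H) ≤ 1 →
        (∀ k : ℕ, 1 ≤ k → k ≤ m - 1 →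
          BohrPoly.coeffRadius A k ≤ 2 * ‖1 - A 1‖ * BohrPoly.fejerConst m k) ∧
        ∀ r : ℝ, 0 ≤ r → r ≤ t m →
          ∑ k ∈ Finset.range m, r ^ k * BohrPoly.coeffRadius A k ≤ ‖A 1‖ + ‖1 - A 1‖ := by
  obtain ⟨t, h1, h2, h3⟩ := BohrPoly.exists_fejerRoots
  refine ⟨t, h1, h2, h3, fun n _ H _ _ _ m hm A _ hA =>
    ⟨fun k hk hkm => BohrPoly.coeffRadius_le hk hkm hA, fun r hr hrt => ?_⟩⟩
  obtain ⟨ht0, -, ht, -⟩ := h1 m hm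
  refine BohrPoly.sum_coeffRadius_le hm hA hr ?_
  rw [← ht]
  exact (BohrPoly.fejerPoly_strictMonoOn hm).monotoneOn hr ht0.le hrt
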